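/- **Generalised Gärtner–Ellis theorem.** *Conventions.* On $\overline{\mathbb R}=\mathbb R\cup\{\pm\infty\}$, $-\infty$ is absorbing for addition, and $a-b:=a+(-b)$. Let $\mathbb R_{\max}=\mathbb R\cup\{-\infty\}$ and write $\vee$ for the maximum. For a function $h$ from a topological space to $\overline{\mathbb R}$, let $\operatorname{ldom}h=\{h<+\infty\}$, $\operatorname{dom}h=\{-\infty<h<+\infty\}$ and $\operatorname{idom}h=\{z\in\operatorname{dom}h:\limsup_{z'\to z}h(z')<+\infty\}$. The function $h$ is *quasi-continuous on its domain* if, for $k=h|_{\operatorname{dom}h}$ and the subspace topology on $\operatorname{dom}h$, every open $G\subset\overline{\mathbb R}$ satisfies $k^{-1}(G)\subset\overline{\operatorname{int}k^{-1}(G)}$. *Quasi-linear forms.* Let $Y$ be a Polish space and let $\mathscr C_b(Y)$ be the set of continuous functions $Y\to\mathbb R_{\max}$ that are bounded above by a real constant. A *continuous quasi-linear form* on $\mathscr C_b(Y)$ is a map $F:\mathscr C_b(Y)\to\mathbb R_{\max}$ that is isotone, satisfies $F(\lambda+\varphi)=\lambda+F(\varphi)$ for all $\lambda\in\mathbb R_{\max}$,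 satisfies $F(\varphi\vee\psi)\le\alpha+(F(\varphi)\vee F(\psi))$ for all $\varphi,\psi$ with some constant $\alpha\in\mathbb R_{\max}$, and satisfies $F(\varphi_k)\to F(\varphi)$ whenever $\varphi_k\in\mathscr C_b(Y)$ is nondecreasing and converges pointwise to $\varphi\in\mathscr C_b(Y)$. Let $\rho(F)$ be the infimum of the admissible $\alpha$. If $\rho(F)\le0$, $F$ is called a *continuous max-plus linear form*. An *l.s.c. density* of $F$ is a lower semicontinuous $f:Y\to\overline{\mathbb R}$ with $F(\varphi)=\sup_{y\in Y}(\varphi(y)-f(y))$ for all $\varphi\in\mathscr C_b(Y)$. The form $F$ is extended by $F(\varphi)=\sup\{F(\psi):\psi\in\mathscr C_b(Y),\ \psi\le\varphi\}$ to lower semicontinuous $\varphi:Y\to\mathbb R_{\max}$, and then by $F(\varphi)=\inf\{F(\psi):\psi:Y\to\mathbb R_{\max}\text{ l.s.c.},\ \psi\ge\varphi\}$ to all $\varphi:Y\to\mathbb R_{\max}$. For $A\subset Y$, $F(A):=F(\mathbf 1_A)$, where $\mathbf 1_A=0$ on $A$ and $\mathbf 1_A=-\infty$ off $A$. *Weak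 convergence* of forms is pointwise convergence on $\mathscr C_b(Y)$, and accumulation points are taken in the corresponding topology. *Kernel.* Let $X$ be a Hausdorff space and let $b:X\times Y\to\mathbb R_{\max}$ be lower semicontinuous in the second variable, such that for every $x$ there is $y$ with $b(x,y)\in\mathbb R$, and for every $y$ there is $x$ with $b(x,y)\in\mathbb R$. The kernel $b$ is *strongly coercive* if for every $x\in X$ and every neighbourhood $V$ of $x$ there is a finite $W\subset V$ such that $\{y\in Y:\sup_{z\in W}b(z,y)-b(x,y)\le\beta\}$ is relatively compact for every $\beta\in\mathbb R$. For $g:X\to\overline{\mathbb R}$ put $$B^\circ g(y)=\sup_{x\in X}\,(b(x,y)-g(x)),$$ $$\partial^\circ g(x)=\{y\in Y: b(x,y)\in\mathbb R,\ b(x',y)-g(x')\le b(x,y)-g(x)\ \ \forall x'\in X\},$$ $$(\partial^\circ g)^{-1}(y)=\{x\in X:y\in\partial^\circ g(x)\}.$$ *Coverings.* Let $D=\operatorname{ldom}B^\circ g$ and $S_y=(\partial^\circ g)^{-1}(y)$. The family $\{S_y\}_{y\in D}$ is a covering of $\operatorname{idom}g$ if $\operatorname{idom}g\subset\bigcup_{y\in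 D}S_y$. Let $Z_a$ (resp. $Z_t$) be the set of $y\in D$ such that $\operatorname{idom}g\not\subset\bigcup_{y'\in D\setminus\{y\}}S_{y'}$ (resp. $\operatorname{idom}g\not\subset\bigcup_{y'\in D\setminus U}S_{y'}$ for every open neighbourhood $U$ of $y$). Let $Z=Z_a\cup\operatorname{int}Z_t$, the interior being relative to $\operatorname{dom}B^\circ g$. The covering is *topologically minimal* if $Z_t=D$. **Theorem.** Let $(F_n)_{n\in\mathbb N}$ be a sequence of continuous quasi-linear forms on $\mathscr C_b(Y)$ with $\rho(F_n)\to0$. Assume that $g(x)=\lim_{n\to\infty}F_n(b(x,\cdot))$ exists in $\overline{\mathbb R}$ for every $x\in X$. Assume that * either $Y$ is discrete, or $b$ is continuous in the second variable and $B^\circ g(y)>-\infty$ for all $y\in Y$; * $b$ is strongly coercive; * $B^\circ g$ is quasi-continuous on its domain; * there is $x_0\in\operatorname{idom}g$ such that $b(x_0,\cdot)$ is bounded below by a real constant. Let $\overline F(\varphi)=\sup_{y\in Y}(\varphi(y)-B^\circ g(y))$ for $\varphi:Y\to\mathbb R_{\max}$, and $\overline F(A)=\overline F(\mathbf 1_A)$.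 Then $\overline F$ is a continuous max-plus linear form on $\mathscr C_b(Y)$, and: 1. some subsequence of $(F_n)$ converges weakly to a continuous max-plus linear form; 2. $\{(\partial^\circ g)^{-1}(y)\}_{y\in\operatorname{ldom}B^\circ g}$ is a covering of $\operatorname{idom}g$; 3. every continuous quasi-linear form $F$ that is an accumulation point of $(F_n)$ for weak convergence is max-plus linear and has a unique l.s.c. density $f$, and $f\ge B^\circ g$; moreover $\limsup_{n\to\infty}F_n(C)\le\overline F(C)$ for all closed $C\subset Y$; 4. for $F$ and $f$ as in 3, $f=B^\circ g$ on $Z$; moreover $\liminf_{n\to\infty}F_n(G)\ge\overline F(G\cap Z)$ for all open $G\subset Y$; 5. if the covering in 2 is topologically minimal, then $(F_n)$ converges weakly to $\overline F$. -/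

import Mathlib

open Filter Topology

/- Conventions. `EReal` is the extended real line; in Mathlib `⊥ + ⊤ = ⊥`, so `-∞` is absorbing for
addition, and `a - b` is `a + (-b)`. The set `ℝ ∪ {-∞}` is rendered by elements of `EReal` different
from `⊤`. -/

namespace MaxPlus

section Conjugacy

variable {X Y : Type*}

/-- The dual Moreau conjugate `B° g (y) = sup_x (b(x,y) - g(x))`. -/
noncomputable def dualConj (b : X → Y → EReal) (g : X → EReal) (y : Y) : EReal :=
  ⨆ x : X, (b x y - g x)

/-- The subdifferential `∂° g (x)` of `g` at `x` with respect to the transposed kernel. -/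
def dualSubdiff (b : X → Y → EReal) (g : X → EReal) (x : X) : Set Y :=
  {y | b x y ≠ ⊥ ∧ b x y ≠ ⊤ ∧ ∀ x' : X, b x' y - g x' ≤ b x y - g x}

/-- The inverse `(∂° g)⁻¹(y) = {x | y ∈ ∂° g (x)}`. -/
def dualSubdiffInv (b : X → Y → EReal) (g : X → EReal) (y : Y) : Set X :=
  {x | y ∈ dualSubdiff b g x}

/-- The function `b_{x,V} : y ↦ sup_{z ∈ V} b(z,y) - b(x,y)`. -/
noncomputable def coerciveFun (b : X → Y → EReal) (x : X) (V : Set X) (y : Y) : EReal :=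
  (⨆ z ∈ V, b z y) - b x y

/-- Standing assumptions on a kernel: values in `ℝ ∪ {-∞}`, lower semicontinuity in the second
variable, and no row or column identically `-∞`. -/
structure IsKernel [TopologicalSpace Y] (b : X → Y → EReal) : Prop where
  ne_top : ∀ x y, b x y ≠ ⊤
  lsc : ∀ x, LowerSemicontinuous (b x)
  exists_right : ∀ x, ∃ y, b x y ≠ ⊥
  exists_left : ∀ y, ∃ x, b x y ≠ ⊥

/-- Strong coercivity: for every `x` and every neighbourhood `V` of `x` there is a finite `W ⊆ V`
such that all finite sublevel sets of `b_{x,W}` are relatively compact. -/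
def StronglyCoercive [TopologicalSpace X] [TopologicalSpace Y] (b : X → Y → EReal) : Prop :=
  ∀ x : X, ∀ V ∈ 𝓝 x, ∃ W : Set X, W.Finite ∧ W ⊆ V ∧
    ∀ β : ℝ, IsCompact (closure {y : Y | coerciveFun b x W y ≤ (β : EReal)})

end Conjugacy

section Domains

variable {Z : Type*}

/-- `{z | h z < +∞}`. -/
def lowerDom (h : Z → EReal) : Set Z := {z | h z < ⊤}

/-- `{z | h z > -∞}`. -/
def upperDom (h : Z → EReal) : Set Z := {z | ⊥ < h z}

/-- The domain: the points where `h` is real-valued. -/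
def dom (h : Z → EReal) : Set Z := lowerDom h ∩ upperDom h

/-- `idom h`: the points `z` of the domain with `limsup_{z' → z} h(z') < +∞`. -/
def idom [TopologicalSpace Z] (h : Z → EReal) : Set Z :=
  {z | z ∈ dom h ∧ limsup h (𝓝 z) < ⊤}

/-- Quasi-continuity: the inverse image of each open set lies in the closure of its interior. -/
def QuasiContinuous [TopologicalSpace Z] (h : Z → EReal) : Prop :=
  ∀ G : Set EReal, IsOpen G → h ⁻¹' G ⊆ closure (interior (h ⁻¹' G))

/-- Quasi-continuity of `h` on its domain: the restriction of `h` to `dom h`, with the subspace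
topology, is quasi-continuous. -/
def QuasiContinuousOnDom [TopologicalSpace Z] (h : Z → EReal) : Prop :=
  QuasiContinuous (fun z : dom h => h z)

end Domains

section Coverings

variable {I W : Type*}

/-- `{Φ(i)}_{i ∈ I'}` is a covering of `W'`. -/
def IsCovering (Φ : I → Set W) (I' : Set I) (W' : Set W) : Prop :=
  W' ⊆ ⋃ i ∈ I', Φ i

/-- The set of algebraically essential elements of the family `{Φ(i)}_{i ∈ I'}` covering `W'`. -/
def algEssential (Φ : I → Set W) (I' : Set I) (W' : Set W) : Set I :=
  {i | i ∈ I' ∧ ¬ W' ⊆ ⋃ j ∈ I' \ {i}, Φ j}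

/-- The set of topologically essential elements of the family `{Φ(i)}_{i ∈ I'}` covering `W'`
(the open neighbourhoods of `i` in `I'` are the sets `U ∩ I'` with `U` open and `i ∈ U`). -/
def topEssential [TopologicalSpace I] (Φ : I → Set W) (I' : Set I) (W' : Set W) : Set I :=
  {i | i ∈ I' ∧ ∀ U : Set I, IsOpen U → i ∈ U → ¬ W' ⊆ ⋃ j ∈ I' \ U, Φ j}

/-- A covering all of whose indices are topologically essential. -/
def IsTopMinimalCovering [TopologicalSpace I] (Φ : I → Set W) (I' : Set I) (W' : Set W) : Prop :=
  IsCovering Φ I' W' ∧ ∀ i ∈ I', i ∈ topEssential Φ I' W'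

/-- The interior of `S` relative to `D`. -/
def relInterior [TopologicalSpace I] (S D : Set I) : Set I :=
  {i | i ∈ D ∧ ∃ U : Set I, IsOpen U ∧ i ∈ U ∧ U ∩ D ⊆ S}

end Coverings

/-- The set `Z = Z_a ∪ int(Z_t)`, where `Z_a` and `Z_t` are the sets of algebraically and
topologically essential elements of the family `{(∂° g)⁻¹(y)}`, `y` in the lower domain of `B° g`,
covering `idom g`, and the interior is relative to the domain of `B° g`. -/
def essentialSet {X Y : Type*} [TopologicalSpace X] [TopologicalSpace Y]
    (b : X → Y → EReal) (g : X → EReal) : Set Y :=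
  algEssential (dualSubdiffInv b g) (lowerDom (dualConj b g)) (idom g) ∪
    relInterior (topEssential (dualSubdiffInv b g) (lowerDom (dualConj b g)) (idom g))
      (dom (dualConj b g))

section QuasiLinear

/-- `C_b(Y)`: continuous maps from `Y` to `ℝ ∪ {-∞}` bounded above by a real constant, with the
pointwise order. -/
abbrev Cb (Y : Type*) [TopologicalSpace Y] : Type _ :=
  {φ : Y → EReal // Continuous φ ∧ ∃ c : ℝ, ∀ y, φ y ≤ (c : EReal)}

variable {Y : Type*} [TopologicalSpace Y]

/-- The pointwise supremum `φ ∨ ψ`. -/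
noncomputable def Cb.sup (φ ψ : Cb Y) : Cb Y :=
  ⟨fun y => φ.1 y ⊔ ψ.1 y, φ.2.1.sup ψ.2.1, by
    obtain ⟨c, hc⟩ := φ.2.2
    obtain ⟨d, hd⟩ := ψ.2.2
    exact ⟨c ⊔ d, fun y => sup_le
      ((hc y).trans (EReal.coe_le_coe_iff.2 le_sup_left))
      ((hd y).trans (EReal.coe_le_coe_iff.2 le_sup_right))⟩⟩

/-- The scalar action `(a + φ)(y) = a + φ(y)` of `a ∈ ℝ ∪ {-∞}`. -/
noncomputable def Cb.shift (a : EReal) (ha : a ≠ ⊤) (φ : Cb Y) : Cb Y :=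
  ⟨fun y => a + φ.1 y, by
    induction a with
    | bot => simpa using continuous_const
    | top => exact absurd rfl ha
    | coe r =>
      refine continuous_iff_continuousAt.2 fun y => ?_
      exact (EReal.continuousAt_add (Or.inl (EReal.coe_ne_top r))
        (Or.inl (EReal.coe_ne_bot r))).comp
          (f := fun y => ((r : EReal), φ.1 y))
          (continuousAt_const.prodMk φ.2.1.continuousAt), by
    obtain ⟨c, hc⟩ := φ.2.2
    induction a with
    | bot => exact ⟨0, fun y => by simp⟩
    | top => exact absurd rfl ha
    | coe r =>
      exact ⟨r + c, fun y => by
        rw [EReal.coe_add]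
        exact add_le_add le_rfl (hc y)⟩⟩

/-- The admissible constants `α ∈ ℝ ∪ {-∞}` in `F(φ ∨ ψ) ≤ α + F(φ) ∨ F(ψ)`. -/
def quasiConstants (F : Cb Y → EReal) : Set EReal :=
  {α | α ≠ ⊤ ∧ ∀ φ ψ : Cb Y, F (φ.sup ψ) ≤ α + (F φ ⊔ F ψ)}

/-- `ρ(F)`, the infimum of the admissible constants. -/
noncomputable def rho (F : Cb Y → EReal) : EReal := sInf (quasiConstants F)

/-- Continuous quasi-linear forms from `C_b(Y)` to `ℝ ∪ {-∞}`; `continuous` says that `F` preserves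
nondecreasing pointwise converging sequences. -/
structure IsQuasiLinear (F : Cb Y → EReal) : Prop where
  ne_top : ∀ φ, F φ ≠ ⊤
  monotone : Monotone F
  homogeneous : ∀ (a : EReal) (ha : a ≠ ⊤) (φ : Cb Y), F (φ.shift a ha) = a + F φ
  quasi : (quasiConstants F).Nonempty
  continuous : ∀ (u : ℕ → Cb Y) (φ : Cb Y), Monotone u →
    (∀ y, Tendsto (fun k => (u k).1 y) atTop (𝓝 (φ.1 y))) →
    Tendsto (fun k => F (u k)) atTop (𝓝 (F φ))

/-- Continuous max-plus linear forms: continuous quasi-linear forms `F` with `ρ(F) ≤ 0`. -/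
def IsMaxPlusLinear (F : Cb Y → EReal) : Prop := IsQuasiLinear F ∧ rho F ≤ 0

/-- The extension of `F` to lower semicontinuous functions:
`F(φ) = sup {F(ψ) | ψ ∈ C_b(Y), ψ ≤ φ}`. -/
noncomputable def lscExt (F : Cb Y → EReal) (φ : Y → EReal) : EReal :=
  ⨆ (ψ : Cb Y) (_ : ψ.1 ≤ φ), F ψ

/-- The maximal extension of `F` to all functions from `Y` to `ℝ ∪ {-∞}`:
`F(φ) = inf {F(ψ) | ψ : Y → ℝ ∪ {-∞} l.s.c., ψ ≥ φ}`. -/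
noncomputable def maxExt (F : Cb Y → EReal) (φ : Y → EReal) : EReal :=
  ⨅ (ψ : Y → EReal) (_ : LowerSemicontinuous ψ ∧ (∀ y, ψ y ≠ ⊤) ∧ φ ≤ ψ), lscExt F ψ

open Classical in
/-- The max-plus characteristic function of `A`: `0` on `A` and `-∞` elsewhere. -/
noncomputable def maxPlusIndicator {Y : Type*} (A : Set Y) (y : Y) : EReal :=
  if y ∈ A then 0 else ⊥

/-- `F(A)`, the value of the maximal extension of `F` at the characteristic function of `A`. -/
noncomputable def setValue (F : Cb Y → EReal) (A : Set Y) : EReal :=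
  maxExt F (maxPlusIndicator A)

/-- The max-plus linear form with density `f`: `φ ↦ sup_y (φ(y) - f(y))`. -/
noncomputable def densityForm {Y : Type*} (f : Y → EReal) (φ : Y → EReal) : EReal :=
  ⨆ y : Y, (φ y - f y)

/-- `f` is a lower semicontinuous density of `F`. -/
def IsLscDensity (f : Y → EReal) (F : Cb Y → EReal) : Prop :=
  LowerSemicontinuous f ∧ ∀ φ : Cb Y, F φ = densityForm f φ.1

/-- Weak convergence of a sequence of forms on `C_b(Y)`. -/
def WeaklyConverges (F : ℕ → Cb Y → EReal) (F' : Cb Y → EReal) : Prop :=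
  ∀ φ : Cb Y, Tendsto (fun n => F n φ) atTop (𝓝 (F' φ))

/-- `F'` is an accumulation point of the sequence `F` for the topology of weak convergence, that is
of pointwise convergence on `C_b(Y)`. -/
def IsWeakAccPt (F : ℕ → Cb Y → EReal) (F' : Cb Y → EReal) : Prop :=
  MapClusterPt F' atTop F

end QuasiLinear

end MaxPlus

open MaxPlus

/-!
The forms `F n` are studied through their pointwise limits `F'` along ultrafilters on `ℕ`. Such
limits always exist, since `EReal` is compact, and a statement about limits inferior, limits
superior or convergence of the whole sequence is a statement about all of them.

Under either alternative of the hypotheses `b x` is continuous. A limit `F'` is monotone,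
homogeneous and exactly max-additive, because `ρ(F n) → 0`. It is tight (`IsUltraLimit.isTight`):
near the base point `x₀` the function `g` is bounded above, and strong coercivity there provides
finitely many kernel functions `b z` whose maximum tends to `+∞` at infinity. A tight max-additive
form is the density form of `f(y) = sup_φ (φ(y) - F'(φ))` (`isLscDensity_canonicalDensity`), by
covering a compact set with finitely many functions nearly attaining this supremum.

From `F'(b x ∧ k) ≤ g x` one gets `f ≥ B° g`. The converse comes from the points of `idom g`: strong
coercivity at `x ∈ idom g` makes `F n (b x)` asymptotically concentrated on a compact set, whence
`g x = b x y - f y` for some `y` (`IsUltraLimit.exists_le_sub`). Then `f y = B° g y` and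
`y ∈ ∂° g (x)`, so that the sets `(∂° g)⁻¹(y)` with `f y = B° g y` already cover `idom g`. Hence `f`
and `B° g` agree at every algebraically essential index, and on a set whose closure contains the
topologically essential ones; quasi-continuity of `B° g` together with lower semicontinuity of `f`
extends the equality to the interior of the latter (`IsUltraLimit.eq_dualConj_of_mem_essentialSet`).

The large deviation bounds follow by comparing characteristic functions with continuous bump
functions that are `0` on a set and `-∞` off a neighbourhood. A countable family of the same
functions determines lower semicontinuous densities, which yields the weakly convergent subsequence
(`exists_weaklyConverges_subseq`).
-/

open MaxPlus

namespace MaxPlus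

/-! ### Arithmetic in `EReal` -/

/-- The Galois connection relating a form and its canonical density. No condition on `r` is needed,
because `-∞` is absorbing for addition. -/
lemma sub_le_comm_of_ne_top {p q r : EReal} (hp : p ≠ ⊤) (hq : q ≠ ⊤) :
    p - q ≤ r ↔ p - r ≤ q := by
  induction p with
  | top => exact absurd rfl hp
  | bot => simp
  | coe p =>
    induction q with
    | top => exact absurd rfl hq
    | bot => induction r <;> simp [← EReal.coe_sub]
    | coe q =>
      induction r with
      | top => simp
      | bot => simp [← EReal.coe_sub]
      | coe r =>
        norm_cast
        constructor <;> intro h <;> linarith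

lemma sub_lt_comm_of_ne_bot {p r : EReal} (hp : p ≠ ⊤) (hp' : p ≠ ⊥) {l : ℝ} (h : p - r < l) :
    p - l < r := by
  lift p to ℝ using ⟨hp, hp'⟩
  induction r with
  | top => simp [← EReal.coe_sub]
  | bot => simp at h
  | coe r =>
    norm_cast at h ⊢
    linarith

lemma le_sub_comm_of_ne_top {p r : EReal} (hp : p ≠ ⊤) {l : ℝ} (h : l ≤ p - r) :
    r ≤ p - l := by
  induction p with
  | top => exact absurd rfl hp
  | bot => simp at h
  | coe p =>
    induction r with
    | top => simp at h
    | bot => exact bot_le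
    | coe r =>
      norm_cast at h ⊢
      linarith

lemma limsup_le_of_ultrafilter {u : ℕ → EReal} {a : EReal}
    (h : ∀ 𝓤 : Ultrafilter ℕ, ↑𝓤 ≤ (atTop : Filter ℕ) → ∃ l ≤ a, Tendsto u 𝓤 (𝓝 l)) :
    limsup u atTop ≤ a := by
  refine le_of_forall_gt_imp_ge_of_dense fun c hc => limsup_le_of_le (h := ?_)
  refine mem_iff_ultrafilter.2 fun 𝓤 h𝓤 => ?_
  obtain ⟨l, hl, hu⟩ := h 𝓤 h𝓤
  exact hu.eventually_le_const (hl.trans_lt hc)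

lemma le_liminf_of_ultrafilter {u : ℕ → EReal} {a : EReal}
    (h : ∀ 𝓤 : Ultrafilter ℕ, ↑𝓤 ≤ (atTop : Filter ℕ) → ∃ l, a ≤ l ∧ Tendsto u 𝓤 (𝓝 l)) :
    a ≤ liminf u atTop := by
  refine le_of_forall_lt_imp_le_of_dense fun c hc => le_liminf_of_le (h := ?_)
  refine mem_iff_ultrafilter.2 fun 𝓤 h𝓤 => ?_
  obtain ⟨l, hl, hu⟩ := h 𝓤 h𝓤
  exact hu.eventually_const_le (hc.trans_le hl)

/-! ### Elements of `C_b(Y)` -/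

section Forms

variable {Y : Type*} [TopologicalSpace Y]

lemma Cb.ne_top (φ : Cb Y) (y : Y) : φ.1 y ≠ ⊤ := by
  obtain ⟨c, hc⟩ := φ.2.2
  exact ((hc y).trans_lt (EReal.coe_lt_top c)).ne

/-- Constant functions in `C_b(Y)`. -/
def Cb.const (c : ℝ) : Cb Y := ⟨fun _ => c, continuous_const, c, fun _ => le_rfl⟩

/-- The truncation `φ ∧ k` of a continuous function that may be unbounded above. -/
noncomputable def Cb.trunc (φ : Y → EReal) (hφ : Continuous φ) (k : ℝ) : Cb Y :=
  ⟨fun y => φ y ⊓ k, hφ.inf continuous_const, k, fun _ => inf_le_right⟩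

/-- Continuous bump functions with value `0` on `V` and `-∞` off `U`: logarithms of Urysohn
functions. -/
lemma exists_bump [NormalSpace Y] {V U : Set Y} (hU : IsOpen U) (h : closure V ⊆ U) :
    ∃ φ : Cb Y, (∀ y ∈ V, φ.1 y = 0) ∧ (∀ y ∉ U, φ.1 y = ⊥) ∧ ∀ y, φ.1 y ≤ 0 := by
  obtain ⟨f, hf0, hf1, hf⟩ := exists_continuous_zero_one_of_isClosed hU.isClosed_compl
    isClosed_closure (Set.disjoint_left.2 fun y hy hy' => hy (h hy'))
  have hle : ∀ y, ENNReal.log (ENNReal.ofReal (f y)) ≤ 0 := fun y => by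
    rw [← ENNReal.log_one]
    exact ENNReal.log_le_log (by simpa using (hf y).2)
  refine ⟨⟨fun y => ENNReal.log (ENNReal.ofReal (f y)),
    ENNReal.continuous_log.comp (ENNReal.continuous_ofReal.comp f.continuous), 0,
    by simpa using hle⟩, fun y hy => ?_, fun y hy => ?_, hle⟩
  · simp [hf1 (subset_closure hy)]
  · simp [hf0 (show y ∈ Uᶜ from hy)]

/-! ### Forms with a density -/

/-- The algebraic part of max-plus linearity: everything except the preservation of monotone
limits. -/
structure IsMaxAdditive (F : Cb Y → EReal) : Prop where
  ne_top : ∀ φ, F φ ≠ ⊤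
  monotone : Monotone F
  homogeneous : ∀ (a : EReal) (ha : a ≠ ⊤) (φ : Cb Y), F (φ.shift a ha) = a + F φ
  sup_le : ∀ φ ψ : Cb Y, F (φ.sup ψ) ≤ F φ ⊔ F ψ

lemma add_densityForm_le (f : Y → EReal) (a : EReal) (ha : a ≠ ⊤) (φ : Cb Y) :
    densityForm f (φ.shift a ha).1 ≤ a + densityForm f φ.1 := by
  refine iSup_le fun y => ?_
  change a + φ.1 y - f y ≤ _
  rw [sub_eq_add_neg, add_assoc, ← sub_eq_add_neg]
  exact add_le_add le_rfl (le_iSup (fun y => φ.1 y - f y) y)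

/-- A form given by a density is max-plus linear as soon as it does not take the value `+∞`. The
preservation of monotone limits is an exchange of two suprema. -/
lemma isMaxPlusLinear_of_density {F : Cb Y → EReal} {f : Y → EReal} (hne : ∀ φ, F φ ≠ ⊤)
    (hf : ∀ φ : Cb Y, F φ = densityForm f φ.1) : IsMaxPlusLinear F := by
  have hmono : Monotone F := fun φ ψ h => by
    rw [hf, hf]
    exact iSup_mono fun y => EReal.sub_le_sub (h y) le_rfl
  have hquasi : (0 : EReal) ∈ quasiConstants F := by
    refine ⟨EReal.zero_ne_top, fun φ ψ => ?_⟩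
    rw [zero_add, hf, hf, hf]
    refine iSup_le fun y => ?_
    rcases le_total (φ.1 y) (ψ.1 y) with h | h
    · refine le_sup_of_le_right (le_iSup_of_le y (EReal.sub_le_sub ?_ le_rfl))
      exact sup_le h le_rfl
    · refine le_sup_of_le_left (le_iSup_of_le y (EReal.sub_le_sub ?_ le_rfl))
      exact sup_le le_rfl h
  refine ⟨⟨hne, hmono, fun a ha φ => ?_, ⟨0, hquasi⟩, fun u φ hu hφ => ?_⟩, sInf_le hquasi⟩
  · refine le_antisymm ?_ ?_
    · rw [hf, hf]
      exact add_densityForm_le f a ha φ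
    · induction a with
      | top => exact absurd rfl ha
      | bot => simp
      | coe a =>
        have h1 := add_densityForm_le f ((-a : ℝ) : EReal) (EReal.coe_ne_top _) (φ.shift a ha)
        have h2 : (φ.shift a ha).shift ((-a : ℝ) : EReal) (EReal.coe_ne_top _) = φ := by
          refine Subtype.ext (funext fun y => ?_)
          change ((-a : ℝ) : EReal) + (a + φ.1 y) = φ.1 y
          rw [← add_assoc, ← EReal.coe_add, neg_add_cancel, EReal.coe_zero, zero_add]
        rw [h2, ← hf, ← hf] at h1
        calc (a : EReal) + F φ ≤ a + (((-a : ℝ) : EReal) + F (φ.shift a ha)) :=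
              add_le_add le_rfl h1
          _ = F (φ.shift a ha) := by
              rw [← add_assoc, ← EReal.coe_add, add_neg_cancel, EReal.coe_zero, zero_add]
  · have hle : ∀ k, u k ≤ φ := fun k y =>
      Monotone.ge_of_tendsto (f := fun k => (u k).1 y) (fun i j hij => hu hij y) (hφ y) k
    suffices h : F φ = ⨆ k, F (u k) by
      rw [h]
      exact tendsto_atTop_iSup (hmono.comp hu)
    refine le_antisymm ?_ (iSup_le fun k => hmono (hle k))
    rw [hf]
    refine iSup_le fun y => ?_
    have hk : ∀ k, (u k).1 y - f y ≤ ⨆ k, F (u k) := fun k => by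
      refine le_trans ?_ (le_iSup _ k)
      rw [hf]
      exact le_iSup (fun y => (u k).1 y - f y) y
    by_cases hft : f y = ⊤
    · simp [hft]
    by_cases hfb : f y = ⊥
    · by_cases hb : φ.1 y = ⊥
      · simp [hb]
      · obtain ⟨k, hk'⟩ := ((hφ y).eventually (lt_mem_nhds (bot_lt_iff_ne_bot.2 hb))).exists
        refine le_trans (le_of_eq ?_) (hk k)
        rw [hfb, sub_eq_add_neg, sub_eq_add_neg, EReal.neg_bot, EReal.add_top_of_ne_bot hb,
          EReal.add_top_of_ne_bot hk'.ne']
    · have hlim : Tendsto (fun k => (u k).1 y - f y) atTop (𝓝 (φ.1 y - f y)) :=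
        (EReal.continuousAt_add (p := (φ.1 y, -f y)) (Or.inr (by simpa using hft))
          (Or.inr (by simpa using hfb))).tendsto.comp ((hφ y).prodMk_nhds tendsto_const_nhds)
      exact le_of_tendsto hlim (Eventually.of_forall hk)

/-- The function `f(y) = sup_φ (φ(y) - F(φ))`, the smallest one with density form at most `F`. -/
noncomputable def canonicalDensity (F : Cb Y → EReal) (y : Y) : EReal :=
  ⨆ φ : Cb Y, (φ.1 y - F φ)

/-- Also for infinite `a`: `φ - ⊥` is `⊤` on the open set `φ ≠ ⊥` and `⊥` elsewhere. -/
lemma lowerSemicontinuous_sub_const {φ : Y → EReal} (hφ : LowerSemicontinuous φ) (a : EReal) :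
    LowerSemicontinuous fun y => φ y - a := by
  induction a with
  | top => simpa using lowerSemicontinuous_const
  | bot =>
    intro y c hc
    have hy : φ y ≠ ⊥ := by
      rintro h
      simp [h] at hc
    filter_upwards [hφ y ⊥ (bot_lt_iff_ne_bot.2 hy)] with z hz
    have e : ∀ t : EReal, t ≠ ⊥ → t - ⊥ = ⊤ := fun t ht => by
      rw [sub_eq_add_neg, EReal.neg_bot, EReal.add_top_of_ne_bot ht]
    change c < φ y - ⊥ at hc
    change c < φ z - ⊥
    rw [e _ hy] at hc
    rwa [e _ hz.ne']
  | coe a =>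
    intro y c hc
    have e : ∀ t : EReal, c < t - a ↔ c + a < t := fun t =>
      EReal.lt_sub_iff_add_lt (Or.inl (EReal.coe_ne_bot a)) (Or.inl (EReal.coe_ne_top a))
    replace hc := (e _).1 hc
    filter_upwards [hφ y _ hc] with z hz
    exact (e _).2 hz

lemma lowerSemicontinuous_canonicalDensity (F : Cb Y → EReal) :
    LowerSemicontinuous (canonicalDensity F) :=
  lowerSemicontinuous_iSup fun φ =>
    lowerSemicontinuous_sub_const φ.2.1.lowerSemicontinuous (F φ)

lemma le_canonicalDensity (F : Cb Y → EReal) (φ : Cb Y) (y : Y) :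
    φ.1 y - F φ ≤ canonicalDensity F y := le_iSup (fun φ : Cb Y => φ.1 y - F φ) φ

lemma densityForm_canonicalDensity_le {F : Cb Y → EReal} (hF : ∀ φ, F φ ≠ ⊤) (φ : Cb Y) :
    densityForm (canonicalDensity F) φ.1 ≤ F φ :=
  iSup_le fun y => (sub_le_comm_of_ne_top (φ.ne_top y) (hF φ)).1 (le_canonicalDensity F φ y)

/-- A lower semicontinuous density is determined by the form, and even by its values on any family
of functions containing, for each `y` and each neighbourhood `U` of `y`, a function that is
`0` at `y`, at most `0` everywhere and `-∞` off `U`. -/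
lemma IsLscDensity.eq_iSup {F : Cb Y → EReal} {f : Y → EReal} (hf : IsLscDensity f F)
    (hF : ∀ φ, F φ ≠ ⊤) {ι : Sort*} (ψ : ι → Cb Y)
    (hψ : ∀ y, ∀ U ∈ 𝓝 y, ∃ i, (ψ i).1 y = 0 ∧ (∀ z ∉ U, (ψ i).1 z = ⊥) ∧ ∀ z, (ψ i).1 z ≤ 0) :
    f = fun y => ⨆ i, ((ψ i).1 y - F (ψ i)) := by
  funext y
  refine le_antisymm ?_ (iSup_le fun i => ?_)
  · refine EReal.ge_of_forall_gt_iff_ge.1 fun a ha => ?_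
    obtain ⟨i, hi, hoff, hle⟩ := hψ y _ (hf.1 y _ ha)
    refine le_iSup_of_le i ?_
    rw [hi, zero_sub]
    refine EReal.le_neg_of_le_neg ?_
    rw [hf.2]
    refine iSup_le fun z => ?_
    by_cases hz : (a : EReal) < f z
    · calc (ψ i).1 z - f z ≤ 0 - a := EReal.sub_le_sub (hle z) hz.le
        _ = -a := zero_sub _
    · rw [hoff z hz, EReal.bot_sub]
      exact bot_le
  · rw [sub_le_comm_of_ne_top ((ψ i).ne_top y) (hF _), hf.2]
    exact le_iSup (fun y => (ψ i).1 y - f y) y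

lemma IsLscDensity.unique [NormalSpace Y] [T1Space Y] {F : Cb Y → EReal} {f f' : Y → EReal}
    (hF : ∀ φ, F φ ≠ ⊤) (hf : IsLscDensity f F) (hf' : IsLscDensity f' F) : f' = f := by
  have hψ : ∀ y : Y, ∀ U ∈ 𝓝 y, ∃ i : Cb Y,
      i.1 y = 0 ∧ (∀ z ∉ U, i.1 z = ⊥) ∧ ∀ z, i.1 z ≤ 0 := fun y U hU => by
    obtain ⟨φ, h1, h2, h3⟩ := exists_bump (V := {y}) (isOpen_interior (s := U))
      (by simpa using mem_interior_iff_mem_nhds.2 hU)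
    exact ⟨φ, h1 y rfl, fun z hz => h2 z fun h => hz (interior_subset h), h3⟩
  rw [hf.eq_iSup hF _ hψ, hf'.eq_iSup hF _ hψ]

/-! ### Finite suprema and compact coverings -/

/-- The quasi-linearity inequality for finite suprema: a function dominated pointwise by finitely
many functions on which `F ≤ B` has `F ≤ card * ε + B`. -/
lemma apply_le_of_finset {F : Cb Y → EReal} (hmono : Monotone F)
    (hhom : ∀ (a : EReal) (ha : a ≠ ⊤) (φ : Cb Y), F (φ.shift a ha) = a + F φ)
    {ε : ℝ} (hε : 0 ≤ ε) (hq : ∀ φ ψ : Cb Y, F (φ.sup ψ) ≤ ε + (F φ ⊔ F ψ))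
    (s : Finset (Cb Y)) {B : EReal} (hB : ∀ χ ∈ s, F χ ≤ B) (ψ : Cb Y)
    (hψ : ∀ y, ∃ χ ∈ s, ψ.1 y ≤ χ.1 y) : F ψ ≤ ((s.card * ε : ℝ) : EReal) + B := by
  classical
  suffices h : ∃ τ : Cb Y, (∀ χ ∈ s, χ ≤ τ) ∧ F τ ≤ ((s.card * ε : ℝ) : EReal) + B by
    obtain ⟨τ, h1, h2⟩ := h
    refine le_trans (hmono fun y => ?_) h2
    obtain ⟨χ, hχ, hy⟩ := hψ y
    exact hy.trans (h1 χ hχ y)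
  clear hψ
  induction s using Finset.induction_on with
  | empty =>
    refine ⟨(Cb.const 0).shift ⊥ bot_ne_top, by simp, ?_⟩
    rw [hhom, EReal.bot_add]
    exact bot_le
  | insert χ s hχ ih =>
    obtain ⟨τ, h1, h2⟩ := ih fun χ' h => hB χ' (Finset.mem_insert_of_mem h)
    refine ⟨χ.sup τ, fun χ' h y => ?_, (hq χ τ).trans ?_⟩
    · rcases Finset.mem_insert.1 h with rfl | h
      · exact le_sup_left
      · exact (h1 χ' h y).trans le_sup_right
    · have h3 : F χ ⊔ F τ ≤ ((s.card * ε : ℝ) : EReal) + B := by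
        refine sup_le ((hB χ (Finset.mem_insert_self _ _)).trans ?_) h2
        calc B = ((0 : ℝ) : EReal) + B := by simp
          _ ≤ _ := add_le_add (EReal.coe_le_coe_iff.2 (by positivity)) le_rfl
      calc (ε : EReal) + (F χ ⊔ F τ) ≤ ε + (((s.card * ε : ℝ) : EReal) + B) :=
            add_le_add le_rfl h3
        _ = _ := by
            rw [← add_assoc, ← EReal.coe_add, Finset.card_insert_of_notMem hχ]
            congr 2
            push_cast
            ring

/-- On a compact set where `φ - f < λ`, with `f` the canonical density of `F`, the function `φ` is
dominated by finitely many functions on which `F < λ`. Each of them is a shift of a function that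
nearly attains the supremum defining `f` at some point. -/
lemma exists_finset_cover {F : Cb Y → EReal} (hF : IsMaxAdditive F) {φ : Y → EReal}
    (hφ : Continuous φ) (hφt : ∀ y, φ y ≠ ⊤) {l : ℝ} {K : Set Y} (hK : IsCompact K)
    (h : ∀ y ∈ K, φ y - canonicalDensity F y < l) :
    ∃ s : Finset (Cb Y), (∀ χ ∈ s, F χ < l) ∧ ∀ y ∈ K, ∃ χ ∈ s, φ y ≤ χ.1 y := by
  classical
  have key : ∀ y, ∃ χ : Cb Y, y ∈ K → F χ < l ∧ φ y < χ.1 y := by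
    intro y
    by_cases hy : y ∈ K
    swap
    · exact ⟨Cb.const 0, fun h => absurd h hy⟩
    have hy' := h y hy
    obtain ⟨l', h1, h2⟩ := EReal.lt_iff_exists_real_btwn.1 hy'
    rcases eq_or_ne (φ y) ⊥ with hb | hb
    · -- A sufficiently negative constant does, since `F` is not `+∞` on constants.
      rcases eq_or_ne (F (Cb.const 0)) ⊥ with h0 | h0
      · exact ⟨Cb.const 0, fun _ => ⟨h0 ▸ EReal.bot_lt_coe l, hb ▸ EReal.bot_lt_coe 0⟩⟩
      · lift F (Cb.const 0) to ℝ using ⟨hF.ne_top _, h0⟩ with q hq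
        refine ⟨(Cb.const 0).shift ((l' - q : ℝ) : EReal) (EReal.coe_ne_top _), fun _ => ⟨?_, ?_⟩⟩
        · rw [hF.homogeneous, ← hq, ← EReal.coe_add]
          simpa using h2
        · change φ y < ((l' - q : ℝ) : EReal) + ((0 : ℝ) : EReal)
          rw [hb, ← EReal.coe_add]
          exact EReal.bot_lt_coe _
    · have h3 : φ y - l' < canonicalDensity F y :=
        sub_lt_comm_of_ne_bot (hφt y) hb h1
      obtain ⟨ψ, hψ⟩ := lt_iSup_iff.1 h3
      have hψb : ψ.1 y ≠ ⊥ := by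
        rintro h0
        simp [h0] at hψ
      have hψy : ((ψ.1 y).toReal : EReal) = ψ.1 y := EReal.coe_toReal (ψ.ne_top y) hψb
      have hφy : ((φ y).toReal : EReal) = φ y := EReal.coe_toReal (hφt y) hb
      rcases eq_or_ne (F ψ) ⊥ with h0 | h0
      · refine ⟨ψ.shift (((φ y).toReal - (ψ.1 y).toReal + 1 : ℝ) : EReal) (EReal.coe_ne_top _),
          fun _ => ⟨?_, ?_⟩⟩
        · rw [hF.homogeneous, h0, EReal.add_bot]
          exact EReal.bot_lt_coe l
        · change φ y < _ + ψ.1 y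
          rw [← hψy, ← hφy, ← EReal.coe_add, EReal.coe_lt_coe_iff, EReal.toReal_coe,
            EReal.toReal_coe]
          linarith
      · have hFψ : ((F ψ).toReal : EReal) = F ψ := EReal.coe_toReal (hF.ne_top ψ) h0
        refine ⟨ψ.shift ((l' - (F ψ).toReal : ℝ) : EReal) (EReal.coe_ne_top _), fun _ => ⟨?_, ?_⟩⟩
        · rw [hF.homogeneous, ← hFψ, ← EReal.coe_add, EReal.toReal_coe]
          simpa using h2
        · change φ y < _ + ψ.1 y
          rw [← hψy, ← hφy, ← hFψ, ← EReal.coe_sub, ← EReal.coe_sub, EReal.coe_lt_coe_iff] at hψ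
          rw [← hψy, ← hφy, ← EReal.coe_add, EReal.coe_lt_coe_iff]
          linarith
  choose χ hχ using key
  obtain ⟨t, ht, hcov⟩ := hK.elim_nhds_subcover (fun y => {z | φ z < (χ y).1 z}) fun y hy =>
    (isOpen_lt hφ (χ y).2.1).mem_nhds (hχ y hy).2
  refine ⟨t.image χ, fun χ' h' => ?_, fun y hy => ?_⟩
  · obtain ⟨z, hz, rfl⟩ := Finset.mem_image.1 h'
    exact (hχ z (ht z hz)).1
  · obtain ⟨z, hz, hyz⟩ := Set.mem_iUnion₂.1 (hcov hy)
    exact ⟨χ z, Finset.mem_image_of_mem _ hz, le_of_lt hyz⟩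

/-- Tightness of `F`: for every level `B`, off some compact set the function `0` is dominated by
finitely many functions on which `F ≤ B`. -/
def IsTight (F : Cb Y → EReal) : Prop :=
  ∀ B : ℝ, ∃ K : Set Y, IsCompact K ∧ ∃ s : Finset (Cb Y),
    (∀ χ ∈ s, F χ ≤ B) ∧ ∀ y ∉ K, ∃ χ ∈ s, 0 ≤ χ.1 y

/-- A tight max-additive form has a lower semicontinuous density. -/
lemma isLscDensity_canonicalDensity {F : Cb Y → EReal} (hF : IsMaxAdditive F) (ht : IsTight F) :
    IsLscDensity (canonicalDensity F) F := by
  classical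
  refine ⟨lowerSemicontinuous_canonicalDensity F, fun φ =>
    le_antisymm ?_ (densityForm_canonicalDensity_le hF.ne_top φ)⟩
  refine EReal.le_of_forall_lt_iff_le.1 fun l hl => ?_
  obtain ⟨c, hc⟩ := φ.2.2
  obtain ⟨K, hK, s, hs, hsK⟩ := ht (l - c)
  obtain ⟨t, ht, htK⟩ := exists_finset_cover hF φ.2.1 φ.ne_top (l := l) hK fun y _ =>
    (le_iSup (fun y => φ.1 y - canonicalDensity F y) y).trans_lt hl
  have := apply_le_of_finset hF.monotone hF.homogeneous le_rfl
    (fun φ ψ => by simpa using hF.sup_le φ ψ)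
    (t ∪ s.image fun χ => χ.shift (c : EReal) (EReal.coe_ne_top c)) (B := l) ?_ φ ?_
  · simpa using this
  · intro χ hχ
    rcases Finset.mem_union.1 hχ with h | h
    · exact (ht χ h).le
    · obtain ⟨χ, hχs, rfl⟩ := Finset.mem_image.1 h
      rw [hF.homogeneous]
      calc (c : EReal) + F χ ≤ c + ((l - c : ℝ) : EReal) := add_le_add le_rfl (hs χ hχs)
        _ = l := by rw [← EReal.coe_add, add_sub_cancel]
  · intro y
    by_cases hy : y ∈ K
    · obtain ⟨χ, h, h'⟩ := htK y hy
      exact ⟨χ, Finset.mem_union_left _ h, h'⟩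
    · obtain ⟨χ, h, h'⟩ := hsK y hy
      refine ⟨_, Finset.mem_union_right _ (Finset.mem_image_of_mem _ h), (hc y).trans ?_⟩
      calc (c : EReal) = c + 0 := (add_zero _).symm
        _ ≤ c + χ.1 y := add_le_add le_rfl h'

end Forms

/-! ### Limits of quasi-linear forms along an ultrafilter -/

section Limits

variable {X Y : Type*} [TopologicalSpace Y]

lemma eventually_sup_le {F : ℕ → Cb Y → EReal} (hrho : Tendsto (fun n => rho (F n)) atTop (𝓝 0))
    {ε : ℝ} (hε : 0 < ε) :
    ∀ᶠ n in atTop, ∀ φ ψ : Cb Y, F n (φ.sup ψ) ≤ ε + (F n φ ⊔ F n ψ) := by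
  filter_upwards [hrho.eventually_lt_const (show (0 : EReal) < ε by exact_mod_cast hε)] with n hn
  obtain ⟨α, hα, hαε⟩ := sInf_lt_iff.1 hn
  exact fun φ ψ => (hα.2 φ ψ).trans (add_le_add hαε.le le_rfl)

lemma le_lscExt (F : Cb Y → EReal) {ψ : Cb Y} {φ : Y → EReal} (h : ψ.1 ≤ φ) : F ψ ≤ lscExt F φ :=
  le_iSup₂ (f := fun (ψ : Cb Y) (_ : ψ.1 ≤ φ) => F ψ) ψ h

/-- Off the closed sublevel set `{b_{x,W} ≤ β}`, wherever `b x` is real, `b x + β` is at most one of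
the `b z`, `z ∈ W`. -/
lemma exists_add_le_of_notMem {b : X → Y → EReal} {x : X} {W : Set X} {β p : ℝ} {y : Y}
    (hp : (p : EReal) ≤ b x y) (ht : b x y ≠ ⊤)
    (hy : y ∉ closure {y : Y | coerciveFun b x W y ≤ (β : EReal)}) :
    ∃ z ∈ W, b x y + β ≤ b z y := by
  have h : (β : EReal) < coerciveFun b x W y := not_le.1 fun h => hy (subset_closure h)
  have hb : b x y ≠ ⊥ := fun h => by simp [h] at hp
  rw [coerciveFun, EReal.lt_sub_iff_add_lt (Or.inl hb) (Or.inl ht), add_comm] at h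
  obtain ⟨z, hz⟩ := lt_iSup_iff.1 h
  obtain ⟨hzW, hz⟩ := lt_iSup_iff.1 hz
  exact ⟨z, hzW, hz.le⟩

/-- The function `(φ ∧ k) - k`. -/
noncomputable def Cb.tail (φ : Y → EReal) (hφ : Continuous φ) (k : ℝ) : Cb Y :=
  (Cb.trunc φ hφ k).shift ((-k : ℝ) : EReal) (EReal.coe_ne_top _)

variable [TopologicalSpace X]

lemma exists_bound_of_mem_idom {g : X → EReal} {x : X} (hx : x ∈ idom g) :
    ∃ M : ℝ, {z | g z < M} ∈ 𝓝 x := by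
  obtain ⟨M, hM, -⟩ := EReal.lt_iff_exists_real_btwn.1 hx.2
  exact ⟨M, eventually_lt_of_limsup_lt hM⟩

/-- The hypotheses under which the forms `F n` are studied, together with a pointwise limit `F'` of
them along an ultrafilter `𝓤`. The function `g` is the limit of `F n (b x)` along the whole
sequence; the continuity of `b x` holds under either alternative of the theorem. -/
structure IsUltraLimit (b : X → Y → EReal) (g : X → EReal) (F : ℕ → Cb Y → EReal)
    (𝓤 : Ultrafilter ℕ) (F' : Cb Y → EReal) : Prop where
  quasiLinear : ∀ n, IsQuasiLinear (F n)
  rho_tendsto : Tendsto (fun n => rho (F n)) atTop (𝓝 0)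
  kernel_ne_top : ∀ x y, b x y ≠ ⊤
  kernel_continuous : ∀ x, Continuous (b x)
  coercive : StronglyCoercive b
  kernel_tendsto : ∀ x, Tendsto (fun n => lscExt (F n) (b x)) atTop (𝓝 (g x))
  base : ∃ x₀ ∈ idom g, ∃ c : ℝ, ∀ y, (c : EReal) ≤ b x₀ y
  le_atTop : ↑𝓤 ≤ (atTop : Filter ℕ)
  tendsto : ∀ φ, Tendsto (fun n => F n φ) 𝓤 (𝓝 (F' φ))

namespace IsUltraLimit

variable {b : X → Y → EReal} {g : X → EReal} {F : ℕ → Cb Y → EReal} {𝓤 : Ultrafilter ℕ}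
  {F' : Cb Y → EReal}

lemma monotone (h : IsUltraLimit b g F 𝓤 F') : Monotone F' := fun φ ψ hφ =>
  le_of_tendsto_of_tendsto' (h.tendsto φ) (h.tendsto ψ) fun n => (h.quasiLinear n).monotone hφ

lemma homogeneous (h : IsUltraLimit b g F 𝓤 F') (a : EReal) (ha : a ≠ ⊤) (φ : Cb Y) :
    F' (φ.shift a ha) = a + F' φ := by
  refine tendsto_nhds_unique (h.tendsto _) ?_
  simp_rw [(h.quasiLinear _).homogeneous]
  induction a with
  | top => exact absurd rfl ha
  | bot => simp
  | coe a =>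
    exact (EReal.continuousAt_add (p := ((a : EReal), F' φ)) (Or.inl (EReal.coe_ne_top a))
      (Or.inl (EReal.coe_ne_bot a))).tendsto.comp (tendsto_const_nhds.prodMk_nhds (h.tendsto φ))

lemma apply_le (h : IsUltraLimit b g F 𝓤 F') {x : X} {φ : Cb Y} (hφ : φ.1 ≤ b x) :
    F' φ ≤ g x :=
  le_of_tendsto_of_tendsto' (h.tendsto φ) ((h.kernel_tendsto x).mono_left h.le_atTop) fun n =>
    le_lscExt (F n) hφ

lemma apply_ne_top (h : IsUltraLimit b g F 𝓤 F') (φ : Cb Y) : F' φ ≠ ⊤ := by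
  obtain ⟨x₀, hx₀, c, hc⟩ := h.base
  obtain ⟨d, hd⟩ := φ.2.2
  have h1 : F' φ ≤ ((d - c : ℝ) : EReal) + F' (Cb.const c) := by
    rw [← h.homogeneous _ (EReal.coe_ne_top _)]
    refine h.monotone fun y => (hd y).trans (le_of_eq ?_)
    change (d : EReal) = ((d - c : ℝ) : EReal) + (c : EReal)
    rw [← EReal.coe_add, sub_add_cancel]
  have h2 : F' (Cb.const c) ≤ g x₀ := h.apply_le hc
  exact (h1.trans_lt (EReal.add_lt_top (EReal.coe_ne_top _) (h2.trans_lt hx₀.1.1).ne)).ne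

lemma isMaxAdditive (h : IsUltraLimit b g F 𝓤 F') : IsMaxAdditive F' := by
  refine ⟨h.apply_ne_top, h.monotone, h.homogeneous, fun φ ψ => ?_⟩
  refine EReal.le_of_forall_lt_iff_le.1 fun l hl => ?_
  obtain ⟨m, hm, hml⟩ := EReal.lt_iff_exists_real_btwn.1 hl
  have hml' : m < l := by exact_mod_cast hml
  refine le_of_tendsto (h.tendsto _) ?_
  filter_upwards [(h.tendsto φ).eventually_lt_const (le_sup_left.trans_lt hm),
    (h.tendsto ψ).eventually_lt_const (le_sup_right.trans_lt hm),
    (eventually_sup_le h.rho_tendsto (sub_pos.2 hml')).filter_mono h.le_atTop] with n h1 h2 h3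
  calc F n (φ.sup ψ) ≤ ((l - m : ℝ) : EReal) + m :=
        (h3 φ ψ).trans (add_le_add le_rfl (sup_le h1.le h2.le))
    _ = l := by rw [← EReal.coe_add, sub_add_cancel]

/-- The limit form is tight: this is strong coercivity at the base point, where `b x₀` is bounded
below. -/
lemma isTight (h : IsUltraLimit b g F 𝓤 F') : IsTight F' := by
  classical
  intro B
  obtain ⟨x₀, hx₀, c, hc⟩ := h.base
  obtain ⟨M, hM⟩ := exists_bound_of_mem_idom hx₀
  obtain ⟨W, hWf, hW, hWc⟩ := h.coercive x₀ _ hM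
  -- With `k = M - B`, the functions `(b z ∧ k) - k`, `z ∈ W`, have `F' ≤ M - k = B`.
  refine ⟨_, hWc (M - B - c), hWf.toFinset.image fun z =>
    Cb.tail (b z) (h.kernel_continuous z) (M - B), fun χ hχ => ?_, fun y hy => ?_⟩
  · obtain ⟨z, hz, rfl⟩ := Finset.mem_image.1 hχ
    rw [Cb.tail, h.homogeneous]
    have h1 : F' (Cb.trunc (b z) (h.kernel_continuous z) (M - B)) ≤ M :=
      (h.apply_le fun y => inf_le_left).trans (hW (hWf.mem_toFinset.1 hz)).le
    calc _ ≤ ((-(M - B) : ℝ) : EReal) + M := add_le_add le_rfl h1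
      _ = B := by rw [← EReal.coe_add]; congr 1; ring
  · obtain ⟨z, hz, hzy⟩ := exists_add_le_of_notMem (hc y) (h.kernel_ne_top _ _) hy
    refine ⟨_, Finset.mem_image_of_mem _ (hWf.mem_toFinset.2 hz), ?_⟩
    have h1 : ((M - B : ℝ) : EReal) ≤ b z y := by
      refine le_trans (le_of_eq ?_) ((add_le_add (hc y) le_rfl).trans hzy)
      rw [← EReal.coe_add, add_sub_cancel]
    change 0 ≤ ((-(M - B) : ℝ) : EReal) + (b z y ⊓ ((M - B : ℝ) : EReal))
    rw [inf_eq_right.2 h1, ← EReal.coe_add, neg_add_cancel, EReal.coe_zero]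

lemma isLscDensity (h : IsUltraLimit b g F 𝓤 F') : IsLscDensity (canonicalDensity F') F' :=
  isLscDensity_canonicalDensity h.isMaxAdditive h.isTight

lemma isMaxPlusLinear (h : IsUltraLimit b g F 𝓤 F') : IsMaxPlusLinear F' :=
  isMaxPlusLinear_of_density h.apply_ne_top h.isLscDensity.2

lemma dualConj_le (h : IsUltraLimit b g F 𝓤 F') (y : Y) :
    dualConj b g y ≤ canonicalDensity F' y := by
  refine iSup_le fun x => ?_
  rcases eq_or_ne (b x y) ⊥ with hb | hb
  · rw [hb, EReal.bot_sub]
    exact bot_le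
  have hby : ((b x y).toReal : EReal) = b x y := EReal.coe_toReal (h.kernel_ne_top x y) hb
  refine le_trans ?_ (le_canonicalDensity F'
    (Cb.trunc (b x) (h.kernel_continuous x) (b x y).toReal) y)
  refine EReal.sub_le_sub (le_of_eq ?_) (h.apply_le fun y => inf_le_left)
  change _ = b x y ⊓ _
  rw [hby, inf_idem]

/-- At each point of `idom g` the supremum of `b x - f`, with `f` the density of the limit form, is
at least `g x` and is attained.

Otherwise `b x - f < g x` on the compact set given by strong coercivity at `x`, so `b x` is
dominated there by finitely many functions with `F' < g x`, and off it by the functions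
`(b z ∧ k) - β`, `z ∈ W`, on which the forms are eventually at most `g x - 1`. Comparing at
finite `n`, uniformly over truncations of `b x`, contradicts `F n (b x) → g x`. -/
lemma exists_le_sub (h : IsUltraLimit b g F 𝓤 F') {x : X} (hx : x ∈ idom g) :
    ∃ y, g x ≤ b x y - canonicalDensity F' y := by
  classical
  by_contra! hcon
  obtain ⟨M, hM⟩ := exists_bound_of_mem_idom hx
  obtain ⟨W, hWf, hW, hWc⟩ := h.coercive x _ hM
  obtain ⟨G, hG⟩ : ∃ G : ℝ, (G : EReal) = g x :=
    ⟨(g x).toReal, EReal.coe_toReal (ne_of_lt hx.1.1) (ne_of_gt hx.1.2)⟩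
  set β : ℝ := M - G + 1 with hβ
  obtain ⟨s, hs, hsK⟩ := exists_finset_cover h.isMaxAdditive (h.kernel_continuous x)
    (h.kernel_ne_top x) (l := G) (hWc β) fun y _ => hG ▸ hcon y
  obtain ⟨B, hB, hBG⟩ : ∃ B : ℝ, (s.sup F' ⊔ ((G - 1 : ℝ) : EReal)) < B ∧ (B : EReal) < G :=
    EReal.lt_iff_exists_real_btwn.1 <| max_lt ((Finset.sup_lt_iff (EReal.bot_lt_coe G)).2 hs)
      (EReal.coe_lt_coe_iff.2 (by linarith))
  have hBG' : B < G := by exact_mod_cast hBG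
  set N : ℕ := s.card + W.ncard with hN
  set ε : ℝ := (G - B) / (2 * (N + 1)) with hε
  have hε0 : 0 < ε := div_pos (sub_pos.2 hBG') (by positivity)
  have hNε : N * ε ≤ (G - B) / 2 := by
    rw [hε, mul_div_assoc', div_le_div_iff₀ (by positivity) (by positivity)]
    nlinarith [sub_pos.2 hBG', (Nat.cast_nonneg N : (0 : ℝ) ≤ N)]
  have hev1 : ∀ᶠ n in (𝓤 : Filter ℕ), ∀ χ ∈ s, F n χ < B :=
    (Finset.eventually_all s).2 fun χ hχ => (h.tendsto χ).eventually_lt_const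
      ((le_sup_of_le_left (Finset.le_sup (f := F') hχ)).trans_lt hB)
  have hev2 : ∀ᶠ n in (𝓤 : Filter ℕ), ∀ z ∈ W, lscExt (F n) (b z) < M :=
    (hWf.eventually_all).2 fun z hz =>
      ((h.kernel_tendsto z).mono_left h.le_atTop).eventually_lt_const (hW hz)
  have hle : g x ≤ (((G + B) / 2 : ℝ) : EReal) := by
    refine le_of_tendsto ((h.kernel_tendsto x).mono_left h.le_atTop) ?_
    filter_upwards [hev1, hev2, (eventually_sup_le h.rho_tendsto hε0).filter_mono h.le_atTop]
      with n h1 h2 h3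
    refine iSup₂_le fun ψ hψ => ?_
    obtain ⟨c, hc⟩ := ψ.2.2
    set t : Finset (Cb Y) := s ∪ hWf.toFinset.image fun z =>
      (Cb.trunc (b z) (h.kernel_continuous z) (c + β)).shift ((-β : ℝ) : EReal)
        (EReal.coe_ne_top _) with ht
    have htN : t.card ≤ N := by
      refine (Finset.card_union_le _ _).trans (add_le_add le_rfl (Finset.card_image_le.trans ?_))
      rw [Set.ncard_eq_toFinset_card W hWf]
    refine (apply_le_of_finset (h.quasiLinear n).monotone (h.quasiLinear n).homogeneous hε0.le h3
      t (B := B) (fun χ hχ => ?_) ψ fun y => ?_).trans ?_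
    · rcases Finset.mem_union.1 hχ with hχ | hχ
      · exact (h1 χ hχ).le
      · obtain ⟨z, hz, rfl⟩ := Finset.mem_image.1 hχ
        rw [(h.quasiLinear n).homogeneous]
        have h4 : F n (Cb.trunc (b z) (h.kernel_continuous z) (c + β)) ≤ M :=
          (le_lscExt (F n) fun y => inf_le_left).trans (h2 z (hWf.mem_toFinset.1 hz)).le
        calc _ ≤ ((-β : ℝ) : EReal) + M := add_le_add le_rfl h4
          _ = ((G - 1 : ℝ) : EReal) := by rw [← EReal.coe_add]; congr 1; rw [hβ]; ring
          _ ≤ B := (le_sup_right.trans_lt hB).le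
    · have hψc : ψ.1 y ≤ b x y ⊓ c := le_inf (hψ y) (hc y)
      by_cases hy : y ∈ closure {y : Y | coerciveFun b x W y ≤ (β : EReal)}
      · obtain ⟨χ, hχ, hle⟩ := hsK y hy
        exact ⟨χ, Finset.mem_union_left _ hχ, (hψ y).trans hle⟩
      rcases eq_or_ne (ψ.1 y) ⊥ with hb | hb
      · -- `W` is nonempty, since otherwise the sublevel set would be all of `Y`.
        obtain ⟨z, hz⟩ : W.Nonempty := by
          by_contra hW0
          rw [Set.not_nonempty_iff_eq_empty] at hW0
          exact hy (subset_closure (by simp [coerciveFun, hW0]))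
        exact ⟨_, Finset.mem_union_right _ (Finset.mem_image_of_mem _ (hWf.mem_toFinset.2 hz)),
          hb ▸ bot_le⟩
      lift ψ.1 y to ℝ using ⟨ψ.ne_top y, hb⟩ with p hp
      obtain ⟨z, hz, hzy⟩ := exists_add_le_of_notMem (hψc.trans inf_le_left)
        (h.kernel_ne_top x y) hy
      refine ⟨_, Finset.mem_union_right _ (Finset.mem_image_of_mem _ (hWf.mem_toFinset.2 hz)), ?_⟩
      change (p : EReal) ≤ ((-β : ℝ) : EReal) + (b z y ⊓ ((c + β : ℝ) : EReal))
      have h5 : ((p + β : ℝ) : EReal) ≤ b z y ⊓ ((c + β : ℝ) : EReal) := by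
        rw [EReal.coe_add, EReal.coe_add]
        exact le_inf ((add_le_add (hψc.trans inf_le_left) le_rfl).trans hzy)
          (add_le_add (hψc.trans inf_le_right) le_rfl)
      calc (p : EReal) = ((-β : ℝ) : EReal) + ((p + β : ℝ) : EReal) := by
            rw [← EReal.coe_add]; congr 1; ring
        _ ≤ _ := add_le_add le_rfl h5
    · rw [← EReal.coe_add, EReal.coe_le_coe_iff]
      have : (t.card : ℝ) * ε ≤ N * ε :=
        mul_le_mul_of_nonneg_right (by exact_mod_cast htN) hε0.le
      linarith
  rw [← hG, EReal.coe_le_coe_iff] at hle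
  linarith

/-- Every point of `idom g` lies in `(∂° g)⁻¹(y)` for some `y` at which the density of the limit
form agrees with `B° g`. This gives the covering property, and confines the essential indices. -/
lemma exists_mem_dualSubdiff (h : IsUltraLimit b g F 𝓤 F') {x : X} (hx : x ∈ idom g) :
    ∃ y, y ∈ dualSubdiff b g x ∧ dualConj b g y < ⊤ ∧
      canonicalDensity F' y = dualConj b g y := by
  obtain ⟨y, hy⟩ := h.exists_le_sub hx
  obtain ⟨G, hG⟩ : ∃ G : ℝ, (G : EReal) = g x :=
    ⟨(g x).toReal, EReal.coe_toReal (ne_of_lt hx.1.1) (ne_of_gt hx.1.2)⟩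
  have hb : b x y ≠ ⊥ := fun hb => by
    rw [hb, EReal.bot_sub, ← hG] at hy
    simp at hy
  have hfle : canonicalDensity F' y ≤ b x y - g x := by
    rw [← hG] at hy ⊢
    exact le_sub_comm_of_ne_top (h.kernel_ne_top x y) hy
  have hle : b x y - g x ≤ dualConj b g y := le_iSup (fun x => b x y - g x) x
  have hu : dualConj b g y = b x y - g x := le_antisymm ((h.dualConj_le y).trans hfle) hle
  refine ⟨y, ⟨hb, h.kernel_ne_top x y, fun x' => ?_⟩, ?_, ?_⟩
  · rw [← hu]
    exact le_iSup (fun x => b x y - g x) x'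
  · rw [hu, ← hG, sub_eq_add_neg, ← EReal.coe_neg]
    exact EReal.add_lt_top (h.kernel_ne_top x y) (EReal.coe_ne_top _)
  · exact le_antisymm (hfle.trans hle) (h.dualConj_le y)

end IsUltraLimit

end Limits

section Essential

variable {X Y : Type*} [TopologicalSpace Y]

/-! ### Essential indices -/

lemma lowerSemicontinuous_dualConj {b : X → Y → EReal} (hb : ∀ x, LowerSemicontinuous (b x))
    (g : X → EReal) : LowerSemicontinuous (dualConj b g) :=
  lowerSemicontinuous_iSup fun x => lowerSemicontinuous_sub_const (hb x) (g x)

variable [TopologicalSpace X]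

namespace IsUltraLimit

variable {b : X → Y → EReal} {g : X → EReal} {F : ℕ → Cb Y → EReal} {𝓤 : Ultrafilter ℕ}
  {F' : Cb Y → EReal}

lemma exists_mem_of_mem_topEssential (h : IsUltraLimit b g F 𝓤 F') {y : Y}
    (hy : y ∈ topEssential (dualSubdiffInv b g) (lowerDom (dualConj b g)) (idom g))
    {U : Set Y} (hU : IsOpen U) (hyU : y ∈ U) :
    ∃ z ∈ U, dualConj b g z < ⊤ ∧ canonicalDensity F' z = dualConj b g z := by
  by_contra! hcon
  refine hy.2 U hU hyU fun x hx => ?_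
  obtain ⟨z, hz, hzt, hzf⟩ := h.exists_mem_dualSubdiff hx
  exact Set.mem_iUnion₂.2 ⟨z, ⟨hzt, fun hzU => hcon z hzU hzt hzf⟩, hz⟩

lemma exists_le_dualConj (h : IsUltraLimit b g F 𝓤 F') :
    ∃ m : ℝ, ∀ y, (m : EReal) ≤ dualConj b g y := by
  obtain ⟨x₀, hx₀, c, hc⟩ := h.base
  obtain ⟨G, hG⟩ : ∃ G : ℝ, (G : EReal) = g x₀ :=
    ⟨(g x₀).toReal, EReal.coe_toReal (ne_of_lt hx₀.1.1) (ne_of_gt hx₀.1.2)⟩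
  refine ⟨c - G, fun y => le_iSup_of_le x₀ ?_⟩
  rw [← hG, EReal.coe_sub]
  exact EReal.sub_le_sub (hc y) le_rfl

/-- The density of the limit form agrees with `B° g` on the essential set. At an algebraically
essential index this is the covering property. Near a point of the interior of the topologically
essential indices, the two functions agree on a dense subset of the domain; since the density is
lower semicontinuous, `f > a > B° g` at the point would hold for `f` nearby, and quasi-continuity
provides an open piece of the domain, arbitrarily near, on which `B° g < a`. -/
lemma eq_dualConj_of_mem_essentialSet (h : IsUltraLimit b g F 𝓤 F')
    (hqc : QuasiContinuousOnDom (dualConj b g)) {y : Y} (hy : y ∈ essentialSet b g) :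
    canonicalDensity F' y = dualConj b g y := by
  rcases hy with ⟨-, hy⟩ | ⟨hyD, U, hU, hyU, hUt⟩
  · by_contra hne
    refine hy fun x hx => ?_
    obtain ⟨z, hz, hzt, hzf⟩ := h.exists_mem_dualSubdiff hx
    exact Set.mem_iUnion₂.2 ⟨z, ⟨hzt, fun hzy => hne (by rwa [← show z = y from hzy])⟩, hz⟩
  · refine le_antisymm (not_lt.1 fun hlt => ?_) (h.dualConj_le y)
    obtain ⟨a, hua, haf⟩ := EReal.lt_iff_exists_real_btwn.1 hlt
    have hV : {z | (a : EReal) < canonicalDensity F' z} ∩ U ∈ 𝓝 y :=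
      inter_mem (lowerSemicontinuous_canonicalDensity F' y _ haf) (hU.mem_nhds hyU)
    obtain ⟨V, hVs, hVo, hyV⟩ := mem_nhds_iff.1 hV
    have hcl := hqc (Set.Iio (a : EReal)) isOpen_Iio
      (show (⟨y, hyD⟩ : dom (dualConj b g)) ∈ _ from hua)
    obtain ⟨w, hwV, hw⟩ := mem_closure_iff.1 hcl (Subtype.val ⁻¹' V)
      (hVo.preimage continuous_subtype_val) hyV
    set A := (fun z : dom (dualConj b g) => dualConj b g z) ⁻¹' Set.Iio (a : EReal)
    obtain ⟨O, hO, hwO⟩ := isOpen_induced_iff.1 (isOpen_interior (s := A))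
    have hwO' : w.1 ∈ O := by
      rw [← hwO] at hw
      exact hw
    obtain ⟨z, ⟨hzV, hzO⟩, hzt, hzf⟩ := h.exists_mem_of_mem_topEssential
      (hUt ⟨(hVs hwV).2, w.2⟩) (hVo.inter hO) ⟨hwV, hwO'⟩
    obtain ⟨m, hm⟩ := h.exists_le_dualConj
    have hzD : z ∈ dom (dualConj b g) := ⟨hzt, (EReal.bot_lt_coe m).trans_le (hm z)⟩
    have hz' : (⟨z, hzD⟩ : dom (dualConj b g)) ∈ Subtype.val ⁻¹' O := hzO
    rw [hwO] at hz'
    have hlt' : dualConj b g z < a := interior_subset (s := A) hz'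
    exact absurd hlt' (not_lt.2 (hzf ▸ (hVs hzV).1.le))

/-- Under topological minimality the density of the limit form is `B° g`. -/
lemma eq_dualConj (h : IsUltraLimit b g F 𝓤 F') (hqc : QuasiContinuousOnDom (dualConj b g))
    (hmin : IsTopMinimalCovering (dualSubdiffInv b g) (lowerDom (dualConj b g)) (idom g)) :
    canonicalDensity F' = dualConj b g := by
  funext y
  obtain ⟨m, hm⟩ := h.exists_le_dualConj
  by_cases hy : dualConj b g y < ⊤
  · exact h.eq_dualConj_of_mem_essentialSet hqc (Or.inr
      ⟨⟨hy, (EReal.bot_lt_coe m).trans_le (hm y)⟩, Set.univ, isOpen_univ, trivial,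
        fun z hz => hmin.2 z hz.2.1⟩)
  · refine le_antisymm ?_ (h.dualConj_le y)
    rw [not_lt_top_iff.1 hy]
    exact le_top

end IsUltraLimit

end Essential

/-! ### Values on sets and subsequences -/

section Sets

variable {Y : Type*} [TopologicalSpace Y]

lemma le_maxPlusIndicator {φ : Cb Y} {G : Set Y} (h0 : ∀ y, φ.1 y ≤ 0) (h : ∀ y ∉ G, φ.1 y = ⊥) :
    φ.1 ≤ maxPlusIndicator G := fun y => by
  by_cases hy : y ∈ G
  · simpa [maxPlusIndicator, hy] using h0 y
  · simp [maxPlusIndicator, hy, h y hy]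

lemma maxPlusIndicator_le {φ : Cb Y} {C : Set Y} (h : ∀ y ∈ C, φ.1 y = 0) :
    maxPlusIndicator C ≤ φ.1 := fun y => by
  by_cases hy : y ∈ C
  · simp [maxPlusIndicator, hy, h y hy]
  · simp [maxPlusIndicator, hy]

lemma le_setValue (F : Cb Y → EReal) {φ : Cb Y} {G : Set Y} (h : φ.1 ≤ maxPlusIndicator G) :
    F φ ≤ setValue F G :=
  le_iInf₂ fun _ hψ => le_lscExt F (h.trans hψ.2.2)

lemma setValue_le {F : Cb Y → EReal} (hF : Monotone F) {φ : Cb Y} {C : Set Y}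
    (h : maxPlusIndicator C ≤ φ.1) : setValue F C ≤ F φ :=
  (iInf₂_le φ.1 ⟨φ.2.1.lowerSemicontinuous, φ.ne_top, h⟩).trans (iSup₂_le fun _ hψ => hF hψ)

/-- For `u` lower semicontinuous and `C` closed, some continuous function above the characteristic
function of `C` has `sup (φ - u)` at most any prescribed number above `sup_C (-u)`. -/
lemma exists_densityForm_le [NormalSpace Y] {u : Y → EReal} (hu : LowerSemicontinuous u)
    {C : Set Y} (hC : IsClosed C) {l : ℝ} (hl : densityForm u (maxPlusIndicator C) < l) :
    ∃ φ : Cb Y, maxPlusIndicator C ≤ φ.1 ∧ densityForm u φ.1 ≤ l := by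
  have hCU : closure C ⊆ {y | ((-l : ℝ) : EReal) < u y} := by
    rw [hC.closure_eq]
    intro y hy
    have h1 := (le_iSup (fun y => maxPlusIndicator C y - u y) y).trans_lt hl
    rw [maxPlusIndicator, if_pos hy, zero_sub] at h1
    exact EReal.neg_lt_comm.1 h1
  obtain ⟨φ, h1, h2, h3⟩ := exists_bump (hu.isOpen_preimage _) hCU
  refine ⟨φ, maxPlusIndicator_le h1, iSup_le fun y => ?_⟩
  by_cases hy : ((-l : ℝ) : EReal) < u y
  · calc φ.1 y - u y ≤ 0 - ((-l : ℝ) : EReal) := EReal.sub_le_sub (h3 y) hy.le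
      _ = l := by rw [zero_sub, ← EReal.coe_neg, neg_neg]
  · rw [h2 y hy, EReal.bot_sub]
    exact bot_le

/-- A countable family of bump functions large enough to determine a form with a lower
semicontinuous density. -/
lemma exists_countable_bumps [RegularSpace Y] [NormalSpace Y] [SecondCountableTopology Y] :
    ∃ S : Set (Cb Y), S.Countable ∧ ∀ y, ∀ U ∈ 𝓝 y,
      ∃ ψ : S, ψ.1.1 y = 0 ∧ (∀ z ∉ U, ψ.1.1 z = ⊥) ∧ ∀ z, ψ.1.1 z ≤ 0 := by
  set 𝓑 := TopologicalSpace.countableBasis Y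
  have h𝓑 := TopologicalSpace.isBasis_countableBasis Y
  have : Countable 𝓑 := (TopologicalSpace.countable_countableBasis Y).to_subtype
  have key : ∀ p : 𝓑 × 𝓑, ∃ φ : Cb Y, closure p.1.1 ⊆ p.2.1 →
      (∀ y ∈ p.1.1, φ.1 y = 0) ∧ (∀ y ∉ p.2.1, φ.1 y = ⊥) ∧ ∀ y, φ.1 y ≤ 0 := fun p => by
    by_cases h : closure p.1.1 ⊆ p.2.1
    · obtain ⟨φ, hφ⟩ := exists_bump (h𝓑.isOpen p.2.2) h
      exact ⟨φ, fun _ => hφ⟩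
    · exact ⟨Cb.const 0, fun h' => absurd h' h⟩
  choose ψ hψ using key
  refine ⟨Set.range ψ, Set.countable_range ψ, fun y U hU => ?_⟩
  obtain ⟨U', hU', hyU', hUU'⟩ := h𝓑.mem_nhds_iff.1 hU
  obtain ⟨V, hV, hyV, hVU⟩ := h𝓑.exists_closure_subset (h𝓑.mem_nhds hU' hyU')
  obtain ⟨h1, h2, h3⟩ := hψ (⟨V, hV⟩, ⟨U', hU'⟩) hVU
  exact ⟨⟨_, Set.mem_range_self _⟩, h1 y hyV, fun z hz => h2 z fun hz' => hz (hUU' hz'), h3⟩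

/-- In the compact space `EReal`, every ultrafilter gives a pointwise limit of the forms. -/
lemma exists_ultrafilter_limit (F : ℕ → Cb Y → EReal) (𝓤 : Ultrafilter ℕ) :
    ∃ F' : Cb Y → EReal, ∀ φ, Tendsto (fun n => F n φ) 𝓤 (𝓝 (F' φ)) :=
  ⟨fun φ => (𝓤.map fun n => F n φ).lim, fun φ => (𝓤.map fun n => F n φ).le_nhds_lim⟩

/-- If every limit of `(F n)` along an ultrafilter avoids `+∞` and has a lower semicontinuous
density, then a subsequence converges weakly: it suffices that it converges on a countable family of
bump functions, because all its ultrafilter limits then have the same density. The limit is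
exhibited as an ultrafilter limit of the whole sequence. -/
lemma exists_weaklyConverges_subseq [RegularSpace Y] [NormalSpace Y] [SecondCountableTopology Y]
    (F : ℕ → Cb Y → EReal)
    (h : ∀ (𝓤 : Ultrafilter ℕ) (F' : Cb Y → EReal), ↑𝓤 ≤ (atTop : Filter ℕ) →
      (∀ φ, Tendsto (fun n => F n φ) 𝓤 (𝓝 (F' φ))) →
        (∀ φ, F' φ ≠ ⊤) ∧ ∃ f, IsLscDensity f F') :
    ∃ (𝓤 : Ultrafilter ℕ) (F' : Cb Y → EReal), ↑𝓤 ≤ (atTop : Filter ℕ) ∧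
      (∀ φ, Tendsto (fun n => F n φ) 𝓤 (𝓝 (F' φ))) ∧
      ∃ σ : ℕ → ℕ, StrictMono σ ∧ WeaklyConverges (fun n => F (σ n)) F' := by
  obtain ⟨S, hS, hψ⟩ := exists_countable_bumps (Y := Y)
  have : Countable S := hS.to_subtype
  obtain ⟨l, σ, hσ, hl⟩ := CompactSpace.tendsto_subseq fun n (ψ : S) => F n ψ
  rw [tendsto_pi_nhds] at hl
  have hmap : ∀ 𝓥 : Ultrafilter ℕ, ↑𝓥 ≤ (atTop : Filter ℕ) →
      ↑(𝓥.map σ) ≤ (atTop : Filter ℕ) := fun 𝓥 h𝓥 => hσ.tendsto_atTop.mono_left h𝓥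
  have hdet : ∀ (𝓥 : Ultrafilter ℕ) (F' : Cb Y → EReal), ↑𝓥 ≤ (atTop : Filter ℕ) →
      (∀ φ, Tendsto (fun n => F n φ) (𝓥.map σ) (𝓝 (F' φ))) →
      ∀ φ, F' φ = densityForm (fun y => ⨆ ψ : S, (ψ.1.1 y - l ψ)) φ.1 := by
    intro 𝓥 F' h𝓥 hF' φ
    obtain ⟨hne, f, hf⟩ := h _ F' (hmap 𝓥 h𝓥) hF'
    have hi : ∀ ψ : S, F' ψ = l ψ := fun ψ =>
      tendsto_nhds_unique ((hF' ψ).comp tendsto_map) ((hl ψ).mono_left h𝓥)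
    have := hf.eq_iSup hne (fun ψ : S => ψ.1) hψ
    simp_rw [hi] at this
    rw [hf.2, this]
  obtain ⟨F', hF'⟩ := exists_ultrafilter_limit F ((Ultrafilter.of atTop).map σ)
  refine ⟨_, F', hmap _ (Ultrafilter.of_le _), hF', σ, hσ, fun φ => ?_⟩
  refine (tendsto_iff_ultrafilter _ _ _).2 fun 𝓥 h𝓥 => ?_
  obtain ⟨F'', hF''⟩ := exists_ultrafilter_limit F (𝓥.map σ)
  rw [hdet _ F' (Ultrafilter.of_le _) hF', ← hdet 𝓥 F'' h𝓥 hF'']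
  exact (hF'' φ).comp tendsto_map

end Sets

end MaxPlus

theorem mainTheorem1 {X Y : Type*} [TopologicalSpace X] [T2Space X]
    [TopologicalSpace Y] [PolishSpace Y]
    (b : X → Y → EReal) (hb : IsKernel b)
    (F : ℕ → Cb Y → EReal) (hF : ∀ n, IsQuasiLinear (F n))
    (hrho : Tendsto (fun n => rho (F n)) atTop (𝓝 0))
    (g : X → EReal)
    (hg : ∀ x, Tendsto (fun n => lscExt (F n) (b x)) atTop (𝓝 (g x)))
    (hA : DiscreteTopology Y ∨ ((∀ x, Continuous (b x)) ∧ ∀ y, ⊥ < dualConj b g y))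
    (hcoer : StronglyCoercive b)
    (hqc : QuasiContinuousOnDom (dualConj b g))
    (hx₀ : ∃ x₀ ∈ idom g, ∃ c : ℝ, ∀ y, (c : EReal) ≤ b x₀ y) :
    -- the form with density `B° g` is a continuous max-plus linear form
    IsMaxPlusLinear (fun φ : Cb Y => densityForm (dualConj b g) φ.1) ∧
    -- existence of a weakly convergent subsequence
    (∃ F' : Cb Y → EReal, IsMaxPlusLinear F' ∧
      ∃ σ : ℕ → ℕ, StrictMono σ ∧ WeaklyConverges (fun n => F (σ n)) F') ∧
    -- covering property
    IsCovering (dualSubdiffInv b g) (lowerDom (dualConj b g)) (idom g) ∧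
    -- every accumulation point has a unique l.s.c. density, which is at least `B° g`,
    -- with equality on `Z`
    (∀ F' : Cb Y → EReal, IsQuasiLinear F' → IsWeakAccPt F F' →
      IsMaxPlusLinear F' ∧
      ∃ f : Y → EReal, IsLscDensity f F' ∧ (∀ f', IsLscDensity f' F' → f' = f) ∧
        (∀ y, dualConj b g y ≤ f y) ∧
        (∀ y ∈ essentialSet b g, f y = dualConj b g y)) ∧
    -- large deviation upper bound
    (∀ C : Set Y, IsClosed C →
      limsup (fun n => setValue (F n) C) atTop ≤
        densityForm (dualConj b g) (maxPlusIndicator C)) ∧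
    -- large deviation lower bound, restricted to `Z`
    (∀ G : Set Y, IsOpen G →
      densityForm (dualConj b g) (maxPlusIndicator (G ∩ essentialSet b g)) ≤
        liminf (fun n => setValue (F n) G) atTop) ∧
    -- full weak convergence under topological minimality
    (IsTopMinimalCovering (dualSubdiffInv b g) (lowerDom (dualConj b g)) (idom g) →
      WeaklyConverges F (fun φ : Cb Y => densityForm (dualConj b g) φ.1)) := by
  have hbc : ∀ x, Continuous (b x) := fun x => by
    rcases hA with hA | hA
    · exact continuous_of_discreteTopology
    · exact hA.1 x
  have hlim : ∀ (𝓤 : Ultrafilter ℕ) (F' : Cb Y → EReal), ↑𝓤 ≤ (atTop : Filter ℕ) →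
      (∀ φ, Tendsto (fun n => F n φ) 𝓤 (𝓝 (F' φ))) → IsUltraLimit b g F 𝓤 F' :=
    fun 𝓤 F' h𝓤 hF' => ⟨hF, hrho, hb.ne_top, hbc, hcoer, hg, hx₀, h𝓤, hF'⟩
  have hex : ∀ 𝓤 : Ultrafilter ℕ, ↑𝓤 ≤ (atTop : Filter ℕ) → ∃ F', IsUltraLimit b g F 𝓤 F' :=
    fun 𝓤 h𝓤 => (exists_ultrafilter_limit F 𝓤).imp fun F' hF' => hlim 𝓤 F' h𝓤 hF'
  obtain ⟨F₀, hF₀⟩ := hex _ (Ultrafilter.of_le atTop)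
  obtain ⟨m, hm⟩ := hF₀.exists_le_dualConj
  refine ⟨isMaxPlusLinear_of_density (fun φ => ?_) fun φ => rfl, ?_, fun x hx => ?_,
    fun F' _ hacc => ?_, fun C hC => ?_, fun G hG => ?_, fun hmin φ => ?_⟩
  · obtain ⟨c, hc⟩ := φ.2.2
    refine ne_top_of_le_ne_top (EReal.coe_ne_top (c - m)) (iSup_le fun y => ?_)
    rw [EReal.coe_sub]
    exact EReal.sub_le_sub (hc y) (hm y)
  · obtain ⟨𝓤, F', h𝓤, hF', σ, hσ, hw⟩ := exists_weaklyConverges_subseq F fun 𝓤 F' h𝓤 hF' =>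
      ⟨(hlim 𝓤 F' h𝓤 hF').apply_ne_top, _, (hlim 𝓤 F' h𝓤 hF').isLscDensity⟩
    exact ⟨F', (hlim 𝓤 F' h𝓤 hF').isMaxPlusLinear, σ, hσ, hw⟩
  · obtain ⟨y, hy, hyt, -⟩ := hF₀.exists_mem_dualSubdiff hx
    exact Set.mem_iUnion₂.2 ⟨y, hyt, hy⟩
  · obtain ⟨𝓤, h𝓤, hF'⟩ := mapClusterPt_iff_ultrafilter.1 hacc
    have h := hlim 𝓤 F' h𝓤 (tendsto_pi_nhds.1 hF')
    exact ⟨h.isMaxPlusLinear, canonicalDensity F', h.isLscDensity,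
      fun f' hf' => h.isLscDensity.unique h.apply_ne_top hf', h.dualConj_le,
      fun y hy => h.eq_dualConj_of_mem_essentialSet hqc hy⟩
  · refine EReal.le_of_forall_lt_iff_le.1 fun l hl => ?_
    obtain ⟨φ, hCφ, hφ⟩ := exists_densityForm_le (lowerSemicontinuous_dualConj hb.lsc g) hC hl
    refine (limsup_le_limsup (Eventually.of_forall fun n =>
      setValue_le (hF n).monotone hCφ)).trans ?_
    refine limsup_le_of_ultrafilter fun 𝓤 h𝓤 => ?_
    obtain ⟨F', h⟩ := hex 𝓤 h𝓤
    refine ⟨F' φ, ?_, h.tendsto φ⟩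
    rw [h.isLscDensity.2]
    exact (iSup_mono fun y => EReal.sub_le_sub le_rfl (h.dualConj_le y)).trans hφ
  · refine iSup_le fun y => ?_
    by_cases hy : y ∈ G ∩ essentialSet b g
    swap
    · simp [maxPlusIndicator, hy]
    obtain ⟨φ, h1, h2, h3⟩ := exists_bump (V := {y}) hG (by simpa using hy.1)
    refine le_trans ?_ (liminf_le_liminf (Eventually.of_forall fun n =>
      le_setValue (F n) (le_maxPlusIndicator h3 h2)))
    refine le_liminf_of_ultrafilter fun 𝓤 h𝓤 => ?_
    obtain ⟨F', h⟩ := hex 𝓤 h𝓤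
    refine ⟨F' φ, ?_, h.tendsto φ⟩
    rw [h.isLscDensity.2, maxPlusIndicator, if_pos hy,
      ← h.eq_dualConj_of_mem_essentialSet hqc hy.2, ← h1 y rfl]
    exact le_iSup (fun y => φ.1 y - canonicalDensity F' y) y
  · refine (tendsto_iff_ultrafilter _ _ _).2 fun 𝓤 h𝓤 => ?_
    obtain ⟨F', h⟩ := hex 𝓤 h𝓤
    have := h.tendsto φ
    rwa [h.isLscDensity.2, h.eq_dualConj hqc hmin] at this
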